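/- **Setting.** Let $m,n\ge 1$, $A\in\mathbb R^{m\times n}$, $b\in\mathbb R^m$, $c\in\mathbb R^n$. Inequalities between vectors are componentwise, $\mathbf 1$ is the all-one vector. Consider the linear programs $$\text{(P)}\quad \max_x\ c^{\mathsf T}x\ \text{ s.t. } Ax\le b,\ x\ge 0,\qquad\qquad \text{(D)}\quad \min_y\ b^{\mathsf T}y\ \text{ s.t. } A^{\mathsf T}y\ge c,\ y\ge 0,$$ and, for $M\in\mathbb R$, the zero-sum game with payoff matrix (to the maximizing row player) $$B_M=\begin{bmatrix}0&A&-b\\-A^{\mathsf T}&0&c\\ b^{\mathsf T}&-c^{\mathsf T}&0\\ \mathbf 1^{\mathsf T}&\mathbf 1^{\mathsf T}&-M\end{bmatrix}.$$ For a payoff matrix $G$, a max-min strategy is a probability vector $q$ on the rows that is part of an optimal solution $(q,u)$ of: maximize $u$ s.t. $q^{\mathsf T}G\ge u\mathbf 1^{\mathsf T}$. A min-max strategy is a probability vector $z$ on the columns that is part of an optimal solution $(z,u)$ of: minimize $u$ s.t. $Gz\le \mathbf 1u$. The value $v$ of the game is the common optimal value of these two problems. **Theorem.** There is some $M\in\mathbb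 R$ (depending on $A,b,c$) with the following properties. If (P) and (D) are both feasible, then they have feasible solutions $x$ and $y$ with $\mathbf 1^{\mathsf T}x+\mathbf 1^{\mathsf T}y+1\le M$. Moreover, the game $B_M$ has a value $v$, and $v\ge 0$, and: (a) $v=0$ if and only if (P) and (D) are both feasible. If $v=0$, then there are $y,x,t$ such that $(y,x,t)$ is a min-max strategy and $(y,x,t,0)$ is a max-min strategy for $B_M$; and for every min-max strategy $(y,x,t)$ of $B_M$ we have $t>0$, $(y,x,t,0)$ is a max-min strategy of $B_M$, $x\frac1t$ is optimal for (P), and $y\frac1t$ is optimal for (D). (b) If $v>0$, then every max-min strategy $(y,x,r,s)$ of $B_M$ satisfies $r=0$, $s=v$ and $$Ax\le 0,\quad x\ge 0,\quad A^{\mathsf T}y\ge 0,\quad y\ge 0,\quad b^{\mathsf T}y-c^{\mathsf T}x<0,$$ and at least one of (P), (D) is infeasible. Moreover, $v<1$, and the smallest real number $w$ for which there exist $\bar x,\bar y$ with $$A\bar x\le b+\mathbf 1w,\quad \bar x\ge 0,\quad -A^{\mathsf T}\bar y\le -c+\mathbf 1w,\quad \bar y\ge 0$$ exists and equals $w=\dfrac{M+1}{1/v-1}$.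 (c) If all entries of $A,b,c$ are rational, let $\alpha$ be the maximum absolute value of the numerators and $\beta$ the maximum of the denominators of these entries (in lowest terms), and let $\ell=m+n+1$. Then $$M=\ell!\,\ell\,\alpha^{\ell}\beta^{\ell^2+\ell}+1$$ is a number $M$ with all the properties above. Its bit-size is polynomial in the bit-size of the data: there is a single polynomial $p$ such that for all $m,n\ge1$ and all rational $A,b,c$ the number of binary digits of this $M$ is at most $p(N)$, where $N$ is the sum over all entries of $A,b,c$ of one plus the numbers of binary digits of its numerator and denominator (zero having no digits). -/

import Mathlib

open Matrix

/-- `x` is feasible for the primal LP: maximize `cᵀx` subject to `Ax ≤ b`, `x ≥ 0`. -/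
def IsPrimalFeasible {m n : ℕ} (A : Matrix (Fin m) (Fin n) ℝ) (b : Fin m → ℝ)
    (x : Fin n → ℝ) : Prop :=
  A *ᵥ x ≤ b ∧ 0 ≤ x

/-- `y` is feasible for the dual LP: minimize `yᵀb` subject to `Aᵀy ≥ c`, `y ≥ 0`. -/
def IsDualFeasible {m n : ℕ} (A : Matrix (Fin m) (Fin n) ℝ) (c : Fin n → ℝ)
    (y : Fin m → ℝ) : Prop :=
  c ≤ Aᵀ *ᵥ y ∧ 0 ≤ y

/-- `x` is an optimal solution of the primal LP. -/
def IsPrimalOptimal {m n : ℕ} (A : Matrix (Fin m) (Fin n) ℝ) (b : Fin m → ℝ) (c : Fin n → ℝ)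
    (x : Fin n → ℝ) : Prop :=
  IsPrimalFeasible A b x ∧ ∀ x', IsPrimalFeasible A b x' → c ⬝ᵥ x' ≤ c ⬝ᵥ x

/-- `y` is an optimal solution of the dual LP. -/
def IsDualOptimal {m n : ℕ} (A : Matrix (Fin m) (Fin n) ℝ) (b : Fin m → ℝ) (c : Fin n → ℝ)
    (y : Fin m → ℝ) : Prop :=
  IsDualFeasible A c y ∧ ∀ y', IsDualFeasible A c y' → b ⬝ᵥ y ≤ b ⬝ᵥ y'

/-- Both the primal and the dual LP are feasible. -/
def BothFeasible {m n : ℕ} (A : Matrix (Fin m) (Fin n) ℝ) (b : Fin m → ℝ)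
    (c : Fin n → ℝ) : Prop :=
  (∃ x, IsPrimalFeasible A b x) ∧ (∃ y, IsDualFeasible A c y)

/-- The mixed strategy `q` of the row player (maximizer) of the zero-sum game with payoff
matrix `G` is a max-min strategy with max-min value `u`: `(q, u)` is an optimal solution of
"maximize `u` subject to `qᵀG ≥ u1ᵀ`, `q` a probability vector". -/
def IsMaxMinWithValue {R C : Type*} [Fintype R] [Fintype C] (G : Matrix R C ℝ)
    (q : R → ℝ) (u : ℝ) : Prop :=
  q ∈ stdSimplex ℝ R ∧ (∀ j, u ≤ (q ᵥ* G) j) ∧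
    ∀ q' ∈ stdSimplex ℝ R, ∀ u' : ℝ, (∀ j, u' ≤ (q' ᵥ* G) j) → u' ≤ u

/-- The mixed strategy `z` of the column player (minimizer) of the zero-sum game with payoff
matrix `G` is a min-max strategy with min-max value `u`: `(z, u)` is an optimal solution of
"minimize `u` subject to `Gz ≤ 1u`, `z` a probability vector". -/
def IsMinMaxWithValue {R C : Type*} [Fintype R] [Fintype C] (G : Matrix R C ℝ)
    (z : C → ℝ) (u : ℝ) : Prop :=
  z ∈ stdSimplex ℝ C ∧ (∀ i, (G *ᵥ z) i ≤ u) ∧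
    ∀ z' ∈ stdSimplex ℝ C, ∀ u' : ℝ, (∀ i, (G *ᵥ z') i ≤ u') → u ≤ u'

/-- `q` is a max-min strategy of the game `G`. -/
def IsMaxMinStrategy {R C : Type*} [Fintype R] [Fintype C] (G : Matrix R C ℝ)
    (q : R → ℝ) : Prop :=
  ∃ u, IsMaxMinWithValue G q u

/-- `z` is a min-max strategy of the game `G`. -/
def IsMinMaxStrategy {R C : Type*} [Fintype R] [Fintype C] (G : Matrix R C ℝ)
    (z : C → ℝ) : Prop :=
  ∃ u, IsMinMaxWithValue G z u

/-- `v` is the value of the zero-sum game `G`: it is both the max-min value and the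
min-max value. -/
def IsGameValue {R C : Type*} [Fintype R] [Fintype C] (G : Matrix R C ℝ) (v : ℝ) : Prop :=
  (∃ q, IsMaxMinWithValue G q v) ∧ (∃ z, IsMinMaxWithValue G z v)

/-- The payoff matrix `B_M`, Dantzig's skew-symmetric game with the extra last row
`(1ᵀ, 1ᵀ, -M)`:
```
[  0    A   -b ]
[ -Aᵀ   0    c ]
[  bᵀ  -cᵀ   0 ]
[  1ᵀ   1ᵀ  -M ]
``` -/
def gameBM {m n : ℕ} (A : Matrix (Fin m) (Fin n) ℝ) (b : Fin m → ℝ) (c : Fin n → ℝ) (M : ℝ) :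
    Matrix (Fin m ⊕ Fin n ⊕ Unit ⊕ Unit) (Fin m ⊕ Fin n ⊕ Unit) ℝ :=
  Matrix.of fun
    | .inl _, .inl _ => 0
    | .inl i, .inr (.inl j) => A i j
    | .inl i, .inr (.inr _) => -b i
    | .inr (.inl j), .inl i => -A i j
    | .inr (.inl _), .inr (.inl _) => 0
    | .inr (.inl j), .inr (.inr _) => c j
    | .inr (.inr (.inl _)), .inl i => b i
    | .inr (.inr (.inl _)), .inr (.inl j) => -c j
    | .inr (.inr (.inl _)), .inr (.inr _) => 0
    | .inr (.inr (.inr _)), .inl _ => 1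
    | .inr (.inr (.inr _)), .inr (.inl _) => 1
    | .inr (.inr (.inr _)), .inr (.inr _) => -M

/-- The column vector `(y, x, t)`. -/
def colVec {m n : ℕ} (y : Fin m → ℝ) (x : Fin n → ℝ) (t : ℝ) : Fin m ⊕ Fin n ⊕ Unit → ℝ :=
  Sum.elim y (Sum.elim x fun _ => t)

/-- The row-player vector `(y, x, r, s)`. -/
def rowVec {m n : ℕ} (y : Fin m → ℝ) (x : Fin n → ℝ) (r s : ℝ) :
    Fin m ⊕ Fin n ⊕ Unit ⊕ Unit → ℝ :=
  Sum.elim y (Sum.elim x (Sum.elim (fun _ => r) fun _ => s))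

/-- Part (a), for the constant `M` and the game value `v`. -/
def PartA {m n : ℕ} (A : Matrix (Fin m) (Fin n) ℝ) (b : Fin m → ℝ) (c : Fin n → ℝ)
    (M v : ℝ) : Prop :=
  (v = 0 ↔ BothFeasible A b c) ∧
  (v = 0 →
    (∃ y x t, IsMinMaxStrategy (gameBM A b c M) (colVec y x t) ∧
      IsMaxMinStrategy (gameBM A b c M) (rowVec y x t 0)) ∧
    (∀ y x t, IsMinMaxStrategy (gameBM A b c M) (colVec y x t) →
      0 < t ∧ IsMaxMinStrategy (gameBM A b c M) (rowVec y x t 0) ∧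
      IsPrimalOptimal A b c (t⁻¹ • x) ∧ IsDualOptimal A b c (t⁻¹ • y)))

/-- Part (b), for the constant `M` and the game value `v`. -/
def PartB {m n : ℕ} (A : Matrix (Fin m) (Fin n) ℝ) (b : Fin m → ℝ) (c : Fin n → ℝ)
    (M v : ℝ) : Prop :=
  0 < v →
    (∀ y x r s, IsMaxMinStrategy (gameBM A b c M) (rowVec y x r s) →
      r = 0 ∧ s = v ∧
      A *ᵥ x ≤ 0 ∧ 0 ≤ x ∧ 0 ≤ Aᵀ *ᵥ y ∧ 0 ≤ y ∧ b ⬝ᵥ y - c ⬝ᵥ x < 0) ∧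
    ¬ BothFeasible A b c ∧
    v < 1 ∧
    IsLeast {w : ℝ | ∃ (x : Fin n → ℝ) (y : Fin m → ℝ),
      (∀ i, (A *ᵥ x) i ≤ b i + w) ∧ 0 ≤ x ∧ (∀ j, -(Aᵀ *ᵥ y) j ≤ -c j + w) ∧ 0 ≤ y}
      ((M + 1) / (1 / v - 1))

/-- `M` has the properties claimed for the data `A, b, c`: it bounds some pair of feasible
solutions if there is one, and the game `B_M` has a value `v ≥ 0` for which (a) and (b) hold. -/
def IsSuitable {m n : ℕ} (A : Matrix (Fin m) (Fin n) ℝ) (b : Fin m → ℝ) (c : Fin n → ℝ)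
    (M : ℝ) : Prop :=
  (BothFeasible A b c → ∃ x y, IsPrimalFeasible A b x ∧ IsDualFeasible A c y ∧
    ∑ j, x j + ∑ i, y i + 1 ≤ M) ∧
  ∃ v, IsGameValue (gameBM A b c M) v ∧ 0 ≤ v ∧ PartA A b c M v ∧ PartB A b c M v

/-- The list of all entries of rational data `A, b, c`. -/
def dataEntry {m n : ℕ} (A : Matrix (Fin m) (Fin n) ℚ) (b : Fin m → ℚ) (c : Fin n → ℚ) :
    (Fin m × Fin n) ⊕ Fin m ⊕ Fin n → ℚ :=
  Sum.elim (fun p => A p.1 p.2) (Sum.elim b c)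

/-- `α`, the maximal absolute value of a numerator of an entry of `A, b, c`. -/
def maxNum {m n : ℕ} (A : Matrix (Fin m) (Fin n) ℚ) (b : Fin m → ℚ) (c : Fin n → ℚ) : ℕ :=
  Finset.univ.sup fun e => (dataEntry A b c e).num.natAbs

/-- `β`, the maximal denominator of an entry of `A, b, c`. -/
def maxDen {m n : ℕ} (A : Matrix (Fin m) (Fin n) ℚ) (b : Fin m → ℚ) (c : Fin n → ℚ) : ℕ :=
  Finset.univ.sup fun e => (dataEntry A b c e).den

/-- The integer `M = ℓ! ℓ α^ℓ β^(ℓ²+ℓ) + 1` with `ℓ = m + n + 1`. -/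
def explicitM {m n : ℕ} (A : Matrix (Fin m) (Fin n) ℚ) (b : Fin m → ℚ) (c : Fin n → ℚ) : ℕ :=
  (m + n + 1).factorial * (m + n + 1) * maxNum A b c ^ (m + n + 1) *
    maxDen A b c ^ ((m + n + 1) ^ 2 + (m + n + 1)) + 1

/-- The bit-size of a rational number: one sign bit and the lengths of the binary
representations of numerator and denominator. -/
def ratBitSize (q : ℚ) : ℕ := 1 + q.num.natAbs.size + q.den.size

/-- The bit-size of the data `A, b, c`: the sum of the bit-sizes of all entries. -/
def dataBitSize {m n : ℕ} (A : Matrix (Fin m) (Fin n) ℚ) (b : Fin m → ℚ) (c : Fin n → ℚ) : ℕ :=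
  ∑ e, ratBitSize (dataEntry A b c e)

/-! Relax (P) and (D) by a common amount `w ≥ 0`, that is, replace `b` by `b + 1w` and `c` by `c -
1w`, and require `bᵀy ≤ cᵀx` in addition. Let `w` be minimal, attained at `(Y, X)`. If `w = 0`, both
programs are feasible and the extra inequality makes `Y` and `X` optimal. If `w > 0`, LP duality
supplies a probability vector `(y, x)` with `Ax ≤ 0`, `Aᵀy ≥ 0` and `cᵀx - bᵀy ≥ w`; by weak duality
it excludes any relaxation smaller than `w`, even without the extra inequality, and in particular
feasibility of both programs.

The first three block rows of `B_M` are skew-symmetric, so a good strategy of either player is again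
a pair solving such a relaxed system. As soon as `M ≥ 1ᵀX + 1ᵀY + 1`, the vectors `(Y, X)` and `(y,
x)` can be combined and scaled to strategies of both players that guarantee `w / (M + w + 1)`, which
is therefore the value (`IsLeastRelaxation.isGameValue`). The claims about arbitrary optimal
strategies then follow from weak duality for relaxed pairs (`IsRelaxedPair.cross`).

Hence `M` only has to bound one optimal solution of the relaxation. For rational data a basic
optimal solution is used (`lp_exists_basic_optimal`): it solves a regular square system, and
Cramer's rule bounds its entries (`abs_le_of_mulVec_eq`). -/

/-! ### Farkas' lemma, LP duality and basic optimal solutions -/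

/-- Farkas' lemma with a linearly independent set of active constraints. -/
theorem farkas_linearIndepOn {ι W : Type*} [DecidableEq ι] [AddCommGroup W] [Module ℝ W]
    (s : Finset ι) : ∀ (a : ι → Module.Dual ℝ W) (b : Module.Dual ℝ W),
      (∀ x, (∀ i ∈ s, 0 ≤ a i x) → 0 ≤ b x) →
      ∃ t ⊆ s, ∃ l : ι → ℝ, (∀ i ∈ t, 0 ≤ l i) ∧ LinearIndepOn ℝ a (t : Set ι) ∧
        b = ∑ i ∈ t, l i • a i := by
  induction s using Finset.induction_on with
  | empty =>
    intro a b h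
    refine ⟨∅, le_rfl, 0, by simp, by simp, ?_⟩
    ext x
    have h1 := h x (by simp)
    have h2 := h (-x) (by simp)
    simp only [map_neg] at h2
    simp only [Finset.sum_empty, LinearMap.zero_apply]
    linarith
  | insert k s hk ih =>
    intro a b h
    by_cases hb : ∀ x, (∀ i ∈ s, 0 ≤ a i x) → 0 ≤ b x
    · obtain ⟨t, hts, l, hl⟩ := ih a b hb
      exact ⟨t, hts.trans (Finset.subset_insert _ _), l, hl⟩
    · push Not at hb
      obtain ⟨x₁, hx₁, hbx₁⟩ := hb
      have hkx₁ : a k x₁ < 0 := by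
        by_contra! hc
        refine absurd (h x₁ fun i hi => ?_) (not_le.2 hbx₁)
        rcases Finset.mem_insert.1 hi with rfl | hi
        · exact hc
        · exact hx₁ i hi
      obtain ⟨x₀, hx₀, hbx₀, hkx₀⟩ :
          ∃ x₀, (∀ i ∈ s, 0 ≤ a i x₀) ∧ b x₀ < 0 ∧ a k x₀ = -1 := by
        have hpos : 0 < (-(a k x₁))⁻¹ := inv_pos.2 (neg_pos.2 hkx₁)
        refine ⟨(-(a k x₁))⁻¹ • x₁, fun i hi => ?_, ?_, ?_⟩
        · simpa using mul_nonneg hpos.le (hx₁ i hi)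
        · simpa using mul_neg_of_pos_of_neg hpos hbx₁
        · have := hkx₁.ne
          simp only [map_smul, smul_eq_mul]
          field_simp
      -- Since `a k x₀ = -1`, the map `x ↦ x + a k x • x₀` projects onto the kernel of `a k`.
      -- Induction is applied to the functionals pulled back along it. Solving the result for `b`
      -- gives `a k` the coefficient chosen below, which is positive because `b x₀ < 0`.
      obtain ⟨t, hts, l, hl, hli, hsum⟩ :=
        ih (fun i => a i + a i x₀ • a k) (b + b x₀ • a k) (fun x hx => by
          have := h (x + a k x • x₀) (fun i hi => by
            rcases Finset.mem_insert.1 hi with rfl | hi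
            · simp [hkx₀]
            · have := hx i hi
              simp only [LinearMap.add_apply, LinearMap.smul_apply, smul_eq_mul] at this
              simp only [map_add, map_smul, smul_eq_mul]
              linarith)
          simp only [map_add, map_smul, smul_eq_mul] at this
          simp only [LinearMap.add_apply, LinearMap.smul_apply, smul_eq_mul]
          linarith)
      have hkt : k ∉ t := fun hc => hk (hts hc)
      refine ⟨insert k t, Finset.insert_subset_insert _ hts,
        fun i => if i = k then ∑ j ∈ t, l j * a j x₀ - b x₀ else l i, ?_, ?_, ?_⟩
      · intro i hi
        rcases Finset.mem_insert.1 hi with rfl | hi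
        · simp only [if_true]
          have : 0 ≤ ∑ j ∈ t, l j * a j x₀ :=
            Finset.sum_nonneg fun j hj => mul_nonneg (hl j hj) (hx₀ j (hts hj))
          linarith
        · have : i ≠ k := fun hc => hkt (hc ▸ hi)
          simpa [this] using hl i hi
      · rw [linearIndepOn_finset_iff] at hli ⊢
        intro g hg
        rw [Finset.sum_insert hkt] at hg
        -- Evaluation at `x₀` expresses `g k` by the other coefficients and turns the relation into
        -- one among the pulled-back functionals.
        have hgk : ∑ i ∈ t, g i * a i x₀ = g k := by
          have := congrArg (fun f => f x₀) hg
          simp [hkx₀] at this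
          linarith
        have hz := hli g (by
          simp only [smul_add, Finset.sum_add_distrib, smul_smul]
          rw [← Finset.sum_smul, hgk, add_comm]
          exact hg)
        intro i hi
        rcases Finset.mem_insert.1 hi with rfl | hi
        · rw [← hgk]
          exact Finset.sum_eq_zero fun j hj => by rw [hz j hj, zero_mul]
        · exact hz i hi
      · have hne : ∀ i ∈ t, i ≠ k := fun i hi hc => hkt (hc ▸ hi)
        rw [Finset.sum_insert hkt]
        beta_reduce
        rw [if_pos rfl, Finset.sum_congr (g := fun i => l i • a i) rfl fun i hi => by
          rw [if_neg (hne i hi)]]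
        simp only [smul_add, Finset.sum_add_distrib, smul_smul] at hsum
        rw [← Finset.sum_smul] at hsum
        ext x
        have := congrArg (fun f => f x) hsum
        simp only [LinearMap.add_apply, LinearMap.smul_apply, smul_eq_mul] at this ⊢
        linarith

/-- Farkas' lemma for the system `K u ≤ k`, `u ≥ 0`. -/
theorem farkas_mulVec_le {R C : Type*} [Fintype R] [Fintype C] (K : Matrix R C ℝ) (k : R → ℝ)
    (h : ∀ v : R → ℝ, 0 ≤ v → 0 ≤ v ᵥ* K → 0 ≤ v ⬝ᵥ k) : ∃ u : C → ℝ, 0 ≤ u ∧ K *ᵥ u ≤ k := by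
  classical
  -- The unit vectors carry the slack: `k` is to lie in the cone spanned by them and the columns of
  -- `K`.
  let a : R ⊕ C → Module.Dual ℝ (R → ℝ) :=
    Sum.elim (fun i => dotProductEquiv ℝ R (Pi.single i 1)) (fun j => dotProductEquiv ℝ R (K.col j))
  obtain ⟨t, -, l, hl, -, hsum⟩ := farkas_linearIndepOn Finset.univ a (dotProductEquiv ℝ R k) (by
    intro v hv
    have := h v (fun i => by simpa [a] using hv (.inl i) (Finset.mem_univ _))
      (fun j => by
        have := hv (.inr j) (Finset.mem_univ _)
        simp only [a, Sum.elim_inr, dotProductEquiv_apply_apply] at this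
        rw [dotProduct_comm] at this
        exact this)
    rw [dotProductEquiv_apply_apply, dotProduct_comm]
    exact this)
  let l' : R ⊕ C → ℝ := fun i => if i ∈ t then l i else 0
  have hl' : ∀ i, 0 ≤ l' i := fun i => by
    by_cases hi : i ∈ t
    · simpa [l', hi] using hl i hi
    · simp [l', hi]
  refine ⟨fun j => l' (.inr j), fun j => hl' _, fun i => ?_⟩
  have h1 : dotProductEquiv ℝ R k = ∑ i, l' i • a i := by
    rw [hsum]
    simp [l', ite_smul]
  have h2 := congrArg (fun f => f (Pi.single i 1)) h1
  simp only [Fintype.sum_sum_type, LinearMap.add_apply, LinearMap.sum_apply, LinearMap.smul_apply,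
    a, Sum.elim_inl, Sum.elim_inr, dotProductEquiv_apply_apply, dotProduct_single_one,
    smul_eq_mul] at h2
  have h3 : ∑ x, l' (.inl x) * (Pi.single x 1 : R → ℝ) i = l' (.inl i) := by
    simp [Pi.single_apply]
  have h4 : (K *ᵥ fun j => l' (.inr j)) i = ∑ x, l' (.inr x) * K.col x i := by
    simp [mulVec, dotProduct, mul_comm]
  have := hl' (.inl i)
  linarith

/-- Strong duality for the linear program `min d ⬝ᵥ z` subject to `G z ≤ h`, `z ≥ 0`. -/
theorem lp_strong_duality {R C : Type*} [Fintype R] [Fintype C] (G : Matrix R C ℝ)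
    (h : R → ℝ) (d : C → ℝ) {z₀ : C → ℝ} (hz₀ : 0 ≤ z₀) (hGz₀ : G *ᵥ z₀ ≤ h)
    {p₀ : R → ℝ} (hp₀ : 0 ≤ p₀) (hGp₀ : 0 ≤ p₀ ᵥ* G + d) :
    ∃ (z : C → ℝ) (p : R → ℝ), 0 ≤ z ∧ G *ᵥ z ≤ h ∧ 0 ≤ p ∧ 0 ≤ p ᵥ* G + d ∧
      d ⬝ᵥ z + p ⬝ᵥ h ≤ 0 := by
  obtain ⟨u, hu, hKu⟩ := farkas_mulVec_le
    (fromRows (fromBlocks G 0 0 (-Gᵀ)) (replicateRow Unit (Sum.elim d h)))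
    (Sum.elim (Sum.elim h d) (fun _ => 0)) (by
    intro v hv hKv
    obtain ⟨v', r', rfl⟩ : ∃ v' r', v = Sum.elim v' r' := ⟨_, _, (Sum.elim_comp_inl_inr v).symm⟩
    obtain ⟨p, z, rfl⟩ : ∃ p z, v' = Sum.elim p z := ⟨_, _, (Sum.elim_comp_inl_inr v').symm⟩
    obtain ⟨r, rfl⟩ : ∃ r, r' = fun _ => r := ⟨r' (), rfl⟩
    have hp : 0 ≤ p := fun i => hv (.inl (.inl i))
    have hz : 0 ≤ z := fun i => hv (.inl (.inr i))
    have hr : 0 ≤ r := hv (.inr ())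
    have h1 : 0 ≤ p ᵥ* G + r • d := fun j => by
      have := hKv (.inl j)
      simpa [vecMul_fromRows, vecMul, dotProduct, Fintype.sum_sum_type] using this
    have h2 : G *ᵥ z ≤ r • h := fun j => by
      have := hKv (.inr j)
      simp [vecMul, dotProduct, Fintype.sum_sum_type] at this
      simpa [mulVec, dotProduct, mul_comm] using this
    have h3 := dotProduct_le_dotProduct_of_nonneg_left h2 hp
    have h4 := dotProduct_nonneg_of_nonneg h1 hz
    simp only [add_dotProduct, smul_dotProduct, dotProduct_smul, smul_eq_mul,
      ← dotProduct_mulVec] at h3 h4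
    -- For `r > 0`, divide by `r`. For `r = 0`, `(p, z)` is a recession direction, and feasibility
    -- of `z₀` and `p₀` gives `p ⬝ᵥ h ≥ 0` and `d ⬝ᵥ z ≥ 0` separately.
    have goal' : 0 ≤ p ⬝ᵥ h + d ⬝ᵥ z := by
      rcases hr.eq_or_lt with rfl | hr
      · have h5 := dotProduct_le_dotProduct_of_nonneg_left hGz₀ hp
        have h6 := dotProduct_nonneg_of_nonneg hGp₀ hz
        have h7 := dotProduct_nonneg_of_nonneg h1 hz₀
        have h8 := dotProduct_le_dotProduct_of_nonneg_left h2 hp₀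
        simp only [add_dotProduct, smul_dotProduct, dotProduct_smul, smul_eq_mul,
          ← dotProduct_mulVec] at h5 h6 h7 h8
        linarith
      · have : 0 ≤ r * (p ⬝ᵥ h + d ⬝ᵥ z) := by linarith
        exact nonneg_of_mul_nonneg_right this hr
    simpa [dotProduct_comm z d] using goal')
  obtain ⟨z, p, rfl⟩ : ∃ z p, u = Sum.elim z p := ⟨_, _, (Sum.elim_comp_inl_inr u).symm⟩
  refine ⟨z, p, fun i => hu (.inl i), fun i => ?_, fun i => hu (.inr i), fun j => ?_, ?_⟩
  · simpa [fromRows_mulVec, fromBlocks_mulVec] using hKu (.inl (.inl i))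
  · have := hKu (.inl (.inr j))
    simp [fromRows_mulVec, fromBlocks_mulVec, neg_mulVec, mulVec_transpose] at this
    simp only [Pi.zero_apply, Pi.add_apply]
    linarith
  · have := hKu (.inr ())
    simpa [fromRows_mulVec, mulVec, replicateRow, dotProduct_comm p h] using this

/-- A linear program `min d ⬝ᵥ z` subject to `G z ≤ h`, `z ≥ 0` that is feasible and has a
feasible dual has an optimal basic solution and an optimal dual solution. -/
theorem lp_exists_basic_optimal {R C : Type*} [Fintype R] [Fintype C] [DecidableEq R]
    (G : Matrix R C ℝ)
    (h : R → ℝ) (d : C → ℝ) {z₀ : C → ℝ} (hz₀ : 0 ≤ z₀) (hGz₀ : G *ᵥ z₀ ≤ h)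
    {p₀ : R → ℝ} (hp₀ : 0 ≤ p₀) (hGp₀ : 0 ≤ p₀ ᵥ* G + d) :
    ∃ (z : C → ℝ) (p : R → ℝ), 0 ≤ z ∧ G *ᵥ z ≤ h ∧ 0 ≤ p ∧ 0 ≤ p ᵥ* G + d ∧
      d ⬝ᵥ z + p ⬝ᵥ h ≤ 0 ∧
      ∃ (f : R → C ⊕ R) (u : R → ℝ), ((fromCols G 1).submatrix id f).det ≠ 0 ∧
        (fromCols G 1).submatrix id f *ᵥ u = h ∧ ∑ j, z j ≤ ∑ i, |u i| := by
  classical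
  obtain ⟨z, p, hz, hGz, hp, hGp, hopt⟩ := lp_strong_duality G h d hz₀ hGz₀ hp₀ hGp₀
  set H : Matrix R (C ⊕ R) ℝ := fromCols G 1 with hH
  let a : C ⊕ R → Module.Dual ℝ (R → ℝ) := fun k => dotProductEquiv ℝ R (H.col k)
  -- complementary slackness: a vector is optimal once its support is contained in this set
  let S : Finset (C ⊕ R) := Finset.univ.filter fun k => (Sum.elim (p ᵥ* G + d) p : C ⊕ R → ℝ) k = 0
  have hslack : p ⬝ᵥ (h - G *ᵥ z) + (p ᵥ* G + d) ⬝ᵥ z ≤ 0 := by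
    simp only [add_dotProduct, dotProduct_sub, ← dotProduct_mulVec]
    linarith
  have hs1 : 0 ≤ p ⬝ᵥ (h - G *ᵥ z) := dotProduct_nonneg_of_nonneg hp (sub_nonneg.2 hGz)
  have hs2 : 0 ≤ (p ᵥ* G + d) ⬝ᵥ z := dotProduct_nonneg_of_nonneg hGp hz
  have hs1' : ∀ i, p i * (h i - (G *ᵥ z) i) = 0 := by
    have : p ⬝ᵥ (h - G *ᵥ z) = 0 := by linarith
    have := (Finset.sum_eq_zero_iff_of_nonneg
      (fun i _ => mul_nonneg (hp i) ((sub_nonneg.2 hGz) i))).1 this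
    exact fun i => this i (Finset.mem_univ _)
  have hs2' : ∀ j, (p ᵥ* G + d) j * z j = 0 := by
    have : (p ᵥ* G + d) ⬝ᵥ z = 0 := by linarith
    have := (Finset.sum_eq_zero_iff_of_nonneg
      (fun i _ => mul_nonneg (hGp i) (hz i))).1 this
    exact fun i => this i (Finset.mem_univ _)
  have hHu : ∀ u : C ⊕ R → ℝ, H *ᵥ u = G *ᵥ (u ∘ Sum.inl) + u ∘ Sum.inr := fun u => by
    rw [hH, fromCols_mulVec, one_mulVec]
  have ha : ∀ (u : C ⊕ R → ℝ) (x : R → ℝ), ∑ k, u k * a k x = (H *ᵥ u) ⬝ᵥ x := fun u x => by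
    simp only [a, dotProductEquiv_apply_apply, mulVec, dotProduct, Matrix.col, Finset.mul_sum,
      Finset.sum_mul, transpose_apply]
    rw [Finset.sum_comm]
    exact Finset.sum_congr rfl fun _ _ => Finset.sum_congr rfl fun _ _ => by ring
  -- The optimal `z` with its slack writes `h` as a nonnegative combination of the columns in `S`.
  -- Farkas replaces it by one with independent columns, still in `S` and hence still optimal.
  obtain ⟨t, htS, l, hl, hli, hsum⟩ := farkas_linearIndepOn S a (dotProductEquiv ℝ R h) (by
    intro x hx
    have h1 : h = H *ᵥ Sum.elim z (h - G *ᵥ z) := by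
      rw [hHu]
      simp
    rw [dotProductEquiv_apply_apply, h1, ← ha]
    refine Finset.sum_nonneg fun k _ => ?_
    by_cases hk : k ∈ S
    · refine mul_nonneg ?_ (hx k hk)
      rcases k with j | i
      · exact hz j
      · exact (sub_nonneg.2 hGz) i
    · have hk' : (Sum.elim (p ᵥ* G + d) p : C ⊕ R → ℝ) k ≠ 0 := by simpa [S] using hk
      rcases k with j | i
      · have := (mul_eq_zero.1 (hs2' j)).resolve_left hk'
        simp [this]
      · have := (mul_eq_zero.1 (hs1' i)).resolve_left hk'
        simp [this])
  let u : C ⊕ R → ℝ := fun k => if k ∈ t then l k else 0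
  have hu : ∀ k, 0 ≤ u k := fun k => by
    by_cases hk : k ∈ t
    · simpa [u, hk] using hl k hk
    · simp [u, hk]
  have huh : H *ᵥ u = h := by
    apply (dotProductEquiv ℝ R).injective
    have : (∑ i ∈ t, l i • a i) = ∑ i, u i • a i := by simp [u, ite_smul]
    rw [hsum, this]
    apply LinearMap.ext
    intro x
    rw [dotProductEquiv_apply_apply, ← ha]
    simp
  have huG : h - G *ᵥ (u ∘ Sum.inl) = u ∘ Sum.inr := by
    rw [← huh, hHu]
    simp
  have huS : ∀ k, (Sum.elim (p ᵥ* G + d) p : C ⊕ R → ℝ) k * u k = 0 := fun k => by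
    by_cases hk : k ∈ t
    · have := (Finset.mem_filter.1 (htS hk)).2
      rw [this, zero_mul]
    · simp [u, hk]
  refine ⟨u ∘ Sum.inl, p, fun j => hu _, ?_, hp, hGp, ?_, ?_⟩
  · rw [← sub_nonneg, huG]
    exact fun j => hu _
  · have e1 : p ⬝ᵥ (u ∘ Sum.inr) = 0 := Finset.sum_eq_zero fun i _ => huS (.inr i)
    have e2 : (p ᵥ* G + d) ⬝ᵥ (u ∘ Sum.inl) = 0 := Finset.sum_eq_zero fun i _ => huS (.inl i)
    rw [← huG] at e1
    simp only [add_dotProduct, dotProduct_sub, ← dotProduct_mulVec] at e1 e2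
    linarith
  · have hli' : LinearIndepOn ℝ (fun k => H.col k) (t : Set (C ⊕ R)) :=
      LinearIndepOn.of_comp (dotProductEquiv ℝ R).toLinearMap hli
    -- The identity block makes the columns of `H` span the whole space, so the independent columns
    -- extend to a basis; the added ones get coefficient zero.
    obtain ⟨B, -, htB, hspan, hB⟩ := exists_linearIndepOn_extension hli' (Set.subset_univ _)
    have htop : ⊤ ≤ Submodule.span ℝ (Set.range fun k : B => H.col k) := by
      rw [← (Pi.basisFun ℝ R).span_eq, Submodule.span_le]
      rintro _ ⟨i, rfl⟩
      have : (Pi.basisFun ℝ R) i = H.col (.inr i) := by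
        ext k
        simp [hH, Matrix.col, Pi.single_apply, one_apply]
      have h2 := hspan ⟨.inr i, Set.mem_univ _, rfl⟩
      rw [this]
      rwa [← Set.image_eq_range]
    let bas := Module.Basis.mk hB htop
    let e : R ≃ B := (Pi.basisFun ℝ R).indexEquiv bas
    have hzero : ∀ k, k ∉ B → u k = 0 := fun k hk => if_neg fun hc => hk (htB hc)
    have hBsum : ∀ F : C ⊕ R → ℝ, (∀ k, k ∉ B → F k = 0) → ∑ i, F (e i) = ∑ k, F k := by
      intro F hF
      refine Fintype.sum_of_injective (fun i => (e i : C ⊕ R))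
        (Subtype.val_injective.comp e.injective) _ _ (fun k hk => hF k fun hkB => hk ?_)
        fun i => rfl
      exact ⟨e.symm ⟨k, hkB⟩, by simp⟩
    refine ⟨fun i => (e i : C ⊕ R), fun i => u (e i), ?_, ?_, ?_⟩
    · have : LinearIndependent ℝ (H.submatrix id fun i => (e i : C ⊕ R)).col :=
        (LinearIndependent.comp hB e e.injective)
      rw [linearIndependent_cols_iff_isUnit, isUnit_iff_isUnit_det] at this
      exact this.ne_zero
    · rw [← huh]
      ext i
      simp only [mulVec, dotProduct, submatrix_apply, id]
      exact hBsum (fun k => H i k * u k) fun k hk => by rw [hzero k hk, mul_zero]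
    · have h1 := hBsum (fun k => |u k|) fun k hk => by rw [hzero k hk, abs_zero]
      rw [h1, Fintype.sum_sum_type]
      have h2 : ∑ j, (u ∘ Sum.inl) j ≤ ∑ j, |u (.inl j)| :=
        Finset.sum_le_sum fun j _ => le_abs_self _
      have h3 : 0 ≤ ∑ i, |u (.inr i)| := Finset.sum_nonneg fun i _ => abs_nonneg _
      linarith

/-! ### Relaxed pairs and the inequalities of the game -/

/-- `(y, x) ≥ 0` satisfies `A x ≤ α b + β 1` and `Aᵀ y ≥ α c - β 1`. -/
def IsRelaxedPair {m n : ℕ} (A : Matrix (Fin m) (Fin n) ℝ) (b : Fin m → ℝ) (c : Fin n → ℝ)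
    (α β : ℝ) (y : Fin m → ℝ) (x : Fin n → ℝ) : Prop :=
  0 ≤ y ∧ 0 ≤ x ∧ (∀ i, (A *ᵥ x) i ≤ α * b i + β) ∧ ∀ j, α * c j - β ≤ (Aᵀ *ᵥ y) j

/-- The relaxation `w ≥ 0` of (P) and (D) is attained at a pair `(Y, X)` with `bᵀY ≤ cᵀX`, and if
`w > 0` there is a dual certificate for its minimality. -/
def IsLeastRelaxation {m n : ℕ} (A : Matrix (Fin m) (Fin n) ℝ) (b : Fin m → ℝ)
    (c : Fin n → ℝ) (Y : Fin m → ℝ) (X : Fin n → ℝ) (w : ℝ) : Prop :=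
  IsRelaxedPair A b c 1 w Y X ∧ 0 ≤ w ∧ b ⬝ᵥ Y ≤ c ⬝ᵥ X ∧
    (0 < w → ∃ y x, IsRelaxedPair A b c 0 0 y x ∧ ∑ i, y i + ∑ j, x j = 1 ∧
      w ≤ c ⬝ᵥ x - b ⬝ᵥ y)

section

variable {m n : ℕ} {A : Matrix (Fin m) (Fin n) ℝ} {b : Fin m → ℝ} {c : Fin n → ℝ}

theorem dotProduct_le_affine {ι : Type*} [Fintype ι] {y F b : ι → ℝ} {α β : ℝ} (hy : 0 ≤ y)
    (h : ∀ i, F i ≤ α * b i + β) : y ⬝ᵥ F ≤ α * (b ⬝ᵥ y) + β * ∑ i, y i := by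
  simp only [dotProduct, Finset.mul_sum]
  rw [← Finset.sum_add_distrib]
  refine Finset.sum_le_sum fun i _ => ?_
  have := mul_le_mul_of_nonneg_left (h i) (hy i)
  linarith

theorem affine_le_dotProduct {ι : Type*} [Fintype ι] {y F b : ι → ℝ} {α β : ℝ} (hy : 0 ≤ y)
    (h : ∀ i, α * b i - β ≤ F i) : α * (b ⬝ᵥ y) - β * ∑ i, y i ≤ y ⬝ᵥ F := by
  simp only [dotProduct, Finset.mul_sum]
  rw [← Finset.sum_sub_distrib]
  refine Finset.sum_le_sum fun i _ => ?_
  have := mul_le_mul_of_nonneg_left (h i) (hy i)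
  linarith

/-- Weak duality: `y'ᵀAx` is bounded above by the constraints on `Ax` and below by those on `Aᵀy'`.
-/
theorem IsRelaxedPair.cross {α β α' β' : ℝ} {y y' : Fin m → ℝ} {x x' : Fin n → ℝ}
    (h : IsRelaxedPair A b c α β y x) (h' : IsRelaxedPair A b c α' β' y' x') :
    α' * (c ⬝ᵥ x) - β' * ∑ j, x j ≤ α * (b ⬝ᵥ y') + β * ∑ i, y' i := by
  have h1 := dotProduct_le_affine h'.1 h.2.2.1
  have h2 := affine_le_dotProduct h.2.1 h'.2.2.2
  have h3 : x ⬝ᵥ (Aᵀ *ᵥ y') = y' ⬝ᵥ (A *ᵥ x) := by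
    rw [mulVec_transpose, dotProduct_comm, ← dotProduct_mulVec]
  linarith

theorem IsRelaxedPair.add {α β α' β' : ℝ} {y y' : Fin m → ℝ} {x x' : Fin n → ℝ}
    (h : IsRelaxedPair A b c α β y x) (h' : IsRelaxedPair A b c α' β' y' x') :
    IsRelaxedPair A b c (α + α') (β + β') (y + y') (x + x') := by
  refine ⟨add_nonneg h.1 h'.1, add_nonneg h.2.1 h'.2.1, fun i => ?_, fun j => ?_⟩
  · rw [mulVec_add, Pi.add_apply]
    linarith [h.2.2.1 i, h'.2.2.1 i]
  · rw [mulVec_add, Pi.add_apply]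
    linarith [h.2.2.2 j, h'.2.2.2 j]

theorem IsRelaxedPair.smul {α β k : ℝ} {y : Fin m → ℝ} {x : Fin n → ℝ} (hk : 0 ≤ k)
    (h : IsRelaxedPair A b c α β y x) :
    IsRelaxedPair A b c (k * α) (k * β) (k • y) (k • x) := by
  refine ⟨smul_nonneg hk h.1, smul_nonneg hk h.2.1, fun i => ?_, fun j => ?_⟩
  · rw [mulVec_smul, Pi.smul_apply, smul_eq_mul]
    have := mul_le_mul_of_nonneg_left (h.2.2.1 i) hk
    linarith
  · rw [mulVec_smul, Pi.smul_apply, smul_eq_mul]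
    have := mul_le_mul_of_nonneg_left (h.2.2.2 j) hk
    linarith

theorem isRelaxedPair_one_zero_iff {y : Fin m → ℝ} {x : Fin n → ℝ} :
    IsRelaxedPair A b c 1 0 y x ↔ IsPrimalFeasible A b x ∧ IsDualFeasible A c y := by
  simp only [IsRelaxedPair, IsPrimalFeasible, IsDualFeasible, Pi.le_def (x := A *ᵥ x),
    Pi.le_def (x := c), one_mul, add_zero, sub_zero]
  tauto

theorem mulVec_gameBM_le_iff {M u : ℝ} {y : Fin m → ℝ} {x : Fin n → ℝ} {t : ℝ} :
    (∀ i, (gameBM A b c M *ᵥ colVec y x t) i ≤ u) ↔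
      (∀ i, (A *ᵥ x) i ≤ t * b i + u) ∧ (∀ j, t * c j - u ≤ (Aᵀ *ᵥ y) j) ∧
        b ⬝ᵥ y - c ⬝ᵥ x ≤ u ∧ ∑ i, y i + ∑ j, x j - M * t ≤ u := by
  simp only [Sum.forall, Unique.forall_iff, gameBM, colVec, mulVec, dotProduct, of_apply,
    Fintype.sum_sum_type, Sum.elim_inl, Sum.elim_inr, zero_mul, Finset.sum_const_zero, zero_add,
    Finset.univ_unique, Finset.sum_singleton, neg_mul, Finset.sum_neg_distrib, transpose_apply,
    one_mul, add_zero]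
  refine and_congr (forall_congr' fun i => ?_) (and_congr (forall_congr' fun i => ?_)
    (and_congr ?_ ?_)) <;> constructor <;> intro h <;> linarith

/-- By skew-symmetry a row strategy obeys the same kind of system as a column strategy, with
relaxation `s - u` in place of `u`. -/
theorem le_vecMul_gameBM_iff {M u : ℝ} {y : Fin m → ℝ} {x : Fin n → ℝ} {r s : ℝ} :
    (∀ j, u ≤ (rowVec y x r s ᵥ* gameBM A b c M) j) ↔
      (∀ i, (A *ᵥ x) i ≤ r * b i + (s - u)) ∧ (∀ j, r * c j - (s - u) ≤ (Aᵀ *ᵥ y) j) ∧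
        b ⬝ᵥ y - c ⬝ᵥ x ≤ -(u + M * s) := by
  simp only [Sum.forall, Unique.forall_iff, gameBM, rowVec, vecMul, mulVec, dotProduct, of_apply,
    Fintype.sum_sum_type, Sum.elim_inl, Sum.elim_inr, mul_zero, Finset.sum_const_zero, zero_add,
    Finset.univ_unique, Finset.sum_singleton, mul_neg, Finset.sum_neg_distrib, transpose_apply,
    mul_one]
  refine and_congr (forall_congr' fun i => ?_) (and_congr (forall_congr' fun j => ?_) ?_)
  · rw [Finset.sum_congr rfl fun j _ => mul_comm (x j) (A i j)]
    constructor <;> intro h <;> linarith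
  · rw [Finset.sum_congr rfl fun i _ => mul_comm (y i) (A i j)]
    constructor <;> intro h <;> linarith
  · rw [Finset.sum_congr rfl fun i _ => mul_comm (y i) (b i),
      Finset.sum_congr rfl fun i _ => mul_comm (x i) (c i)]
    constructor <;> intro h <;> linarith

theorem colVec_mem_stdSimplex_iff {y : Fin m → ℝ} {x : Fin n → ℝ} {t : ℝ} :
    colVec y x t ∈ stdSimplex ℝ (Fin m ⊕ Fin n ⊕ Unit) ↔
      0 ≤ y ∧ 0 ≤ x ∧ 0 ≤ t ∧ ∑ i, y i + ∑ j, x j + t = 1 := by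
  simp [stdSimplex, colVec, Pi.le_def, and_assoc, add_assoc]

theorem rowVec_mem_stdSimplex_iff {y : Fin m → ℝ} {x : Fin n → ℝ} {r s : ℝ} :
    rowVec y x r s ∈ stdSimplex ℝ (Fin m ⊕ Fin n ⊕ Unit ⊕ Unit) ↔
      0 ≤ y ∧ 0 ≤ x ∧ 0 ≤ r ∧ 0 ≤ s ∧ ∑ i, y i + ∑ j, x j + r + s = 1 := by
  simp [stdSimplex, rowVec, Pi.le_def, and_assoc, add_assoc]

theorem vecMul_le_mulVec_of_mem_stdSimplex {R C : Type*} [Fintype R] [Fintype C]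
    {G : Matrix R C ℝ} {q : R → ℝ} {z : C → ℝ} {u u' : ℝ} (hq : q ∈ stdSimplex ℝ R)
    (hz : z ∈ stdSimplex ℝ C) (h : ∀ j, u ≤ (q ᵥ* G) j) (h' : ∀ i, (G *ᵥ z) i ≤ u') : u ≤ u' := by
  have h1 := affine_le_dotProduct (α := 0) (b := 0) (β := -u) hz.1 (F := q ᵥ* G) (by simpa using h)
  have h2 := dotProduct_le_affine (α := 0) (b := 0) (β := u') hq.1 (F := G *ᵥ z) (by simpa using h')
  rw [hz.2] at h1
  rw [hq.2] at h2
  rw [dotProduct_comm z, ← dotProduct_mulVec] at h1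
  linarith

theorem isMaxMinWithValue_of_le {R C : Type*} [Fintype R] [Fintype C]
    {G : Matrix R C ℝ} {q : R → ℝ} {z : C → ℝ} {u : ℝ} (hq : q ∈ stdSimplex ℝ R)
    (hz : z ∈ stdSimplex ℝ C) (h : ∀ j, u ≤ (q ᵥ* G) j) (h' : ∀ i, (G *ᵥ z) i ≤ u) :
    IsMaxMinWithValue G q u ∧ IsMinMaxWithValue G z u :=
  ⟨⟨hq, h, fun _ hq' _ hu' => vecMul_le_mulVec_of_mem_stdSimplex hq' hz hu' h'⟩,
    ⟨hz, h', fun _ hz' _ hu' => vecMul_le_mulVec_of_mem_stdSimplex hq hz' h hu'⟩⟩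

theorem IsGameValue.eq_of_isMaxMinWithValue {R C : Type*} [Fintype R] [Fintype C]
    {G : Matrix R C ℝ} {q : R → ℝ} {u v : ℝ} (hv : IsGameValue G v)
    (h : IsMaxMinWithValue G q u) : u = v := by
  obtain ⟨q', hq'⟩ := hv.1
  exact le_antisymm (hq'.2.2 _ h.1 _ h.2.1) (h.2.2 _ hq'.1 _ hq'.2.1)

theorem IsGameValue.eq_of_isMinMaxWithValue {R C : Type*} [Fintype R] [Fintype C]
    {G : Matrix R C ℝ} {z : C → ℝ} {u v : ℝ} (hv : IsGameValue G v)
    (h : IsMinMaxWithValue G z u) : u = v := by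
  obtain ⟨z', hz'⟩ := hv.2
  exact le_antisymm (h.2.2 _ hz'.1 _ hz'.2.1) (hz'.2.2 _ h.1 _ h.2.1)

/-! ### The value of the game and its optimal strategies -/

/-- A pair with a dual certificate bounds every relaxation from below. -/
theorem IsRelaxedPair.le_of_certificate {α β : ℝ} {y y' : Fin m → ℝ} {x x' : Fin n → ℝ}
    (h : IsRelaxedPair A b c 0 0 y x) (hsum : ∑ i, y i + ∑ j, x j = 1)
    (h' : IsRelaxedPair A b c α β y' x') : α * (c ⬝ᵥ x - b ⬝ᵥ y) ≤ β := by
  have h1 := h.cross h'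
  have h2 := h'.cross h
  have : β * (∑ i, y i + ∑ j, x j) = β := by rw [hsum, mul_one]
  linarith

theorem bothFeasible_iff {Y : Fin m → ℝ} {X : Fin n → ℝ} {w : ℝ}
    (h : IsLeastRelaxation A b c Y X w) : BothFeasible A b c ↔ w = 0 := by
  obtain ⟨hYX, hw, hgap, hcert⟩ := h
  constructor
  · rintro ⟨⟨x₀, hx₀⟩, ⟨y₀, hy₀⟩⟩
    by_contra hne
    obtain ⟨y, x, hyx, hsum, hle⟩ := hcert (lt_of_le_of_ne hw (Ne.symm hne))
    have := hyx.le_of_certificate hsum (isRelaxedPair_one_zero_iff.2 ⟨hx₀, hy₀⟩)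
    exact hne (le_antisymm (by linarith) hw)
  · rintro rfl
    have := isRelaxedPair_one_zero_iff.1 hYX
    exact ⟨⟨X, this.1⟩, ⟨Y, this.2⟩⟩

theorem IsLeastRelaxation.isGameValue {Y : Fin m → ℝ} {X : Fin n → ℝ} {w M : ℝ}
    (h : IsLeastRelaxation A b c Y X w) (hM : ∑ i, Y i + ∑ j, X j + 1 ≤ M) :
    IsGameValue (gameBM A b c M) (w / (M + w + 1)) := by
  obtain ⟨hYX, hw, hgap, hcert⟩ := h
  have hS : 0 ≤ ∑ i, Y i + ∑ j, X j :=
    add_nonneg (Finset.sum_nonneg fun i _ => hYX.1 i) (Finset.sum_nonneg fun j _ => hYX.2.1 j)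
  rcases hw.eq_or_lt with rfl | hw
  · set k : ℝ := (∑ i, Y i + ∑ j, X j + 1)⁻¹ with hk
    have hkpos : 0 < k := inv_pos.2 (by linarith)
    have hk1 : (∑ i, Y i + ∑ j, X j + 1) * k = 1 := mul_inv_cancel₀ (by linarith)
    have hr := hYX.smul hkpos.le
    rw [mul_one, mul_zero] at hr
    have hsum : ∑ i, (k • Y) i + ∑ j, (k • X) j + k = 1 := by
      simp only [Pi.smul_apply, smul_eq_mul, ← Finset.mul_sum]
      linarith
    have hgap' : b ⬝ᵥ (k • Y) - c ⬝ᵥ (k • X) ≤ 0 := by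
      simp only [dotProduct_smul, smul_eq_mul]
      nlinarith
    have := isMaxMinWithValue_of_le (G := gameBM A b c M) (q := rowVec (k • Y) (k • X) k 0)
      (z := colVec (k • Y) (k • X) k) (u := 0)
      (rowVec_mem_stdSimplex_iff.2 ⟨hr.1, hr.2.1, hkpos.le, le_rfl, by linarith⟩)
      (colVec_mem_stdSimplex_iff.2 ⟨hr.1, hr.2.1, hkpos.le, hsum⟩)
      (le_vecMul_gameBM_iff.2 ⟨by simpa using hr.2.2.1, by simpa using hr.2.2.2, by simpa using hgap'⟩)
      (mulVec_gameBM_le_iff.2 ⟨by simpa using hr.2.2.1, by simpa using hr.2.2.2, by simpa using hgap', by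
        nlinarith⟩)
    rw [zero_div]
    exact ⟨⟨_, this.1⟩, ⟨_, this.2⟩⟩
  · obtain ⟨y, x, hyx, hsum, hle⟩ := hcert hw
    set k : ℝ := (M + w + 1)⁻¹ with hk
    have hkpos : 0 < k := inv_pos.2 (by linarith)
    have hk1 : (M + w + 1) * k = 1 := mul_inv_cancel₀ (by linarith)
    -- Adding a multiple of the certificate preserves the relaxed inequalities. This multiple raises
    -- the total weight to `M + w`, so that the last row of the game is tight.
    set l : ℝ := M + w - (∑ i, Y i + ∑ j, X j) with hl
    have hlpos : 0 ≤ l := by linarith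
    have hr := (hYX.add (hyx.smul hlpos)).smul hkpos.le
    simp only [mul_zero, add_zero, mul_one] at hr
    have hsumY : ∑ i, (k • (Y + l • y)) i + ∑ j, (k • (X + l • x)) j = k * (M + w) := by
      simp only [Pi.smul_apply, Pi.add_apply, smul_eq_mul, ← Finset.mul_sum,
        Finset.sum_add_distrib]
      have : l * (∑ i, y i + ∑ j, x j) = l := by rw [hsum, mul_one]
      rw [← mul_add]
      congr 1
      linarith
    have hv : w / (M + w + 1) = k * w := by rw [hk, div_eq_inv_mul]
    have hkw : 0 < k * w := mul_pos hkpos hw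
    have hkw1 : k * w ≤ 1 := by nlinarith
    have hq := hyx.smul (sub_nonneg.2 hkw1)
    simp only [mul_zero] at hq
    have hqsum : ∑ i, ((1 - k * w) • y) i + ∑ j, ((1 - k * w) • x) j = 1 - k * w := by
      simp only [Pi.smul_apply, smul_eq_mul, ← Finset.mul_sum]
      rw [← mul_add, hsum, mul_one]
    have := isMaxMinWithValue_of_le (G := gameBM A b c M)
      (q := rowVec ((1 - k * w) • y) ((1 - k * w) • x) 0 (k * w))
      (z := colVec (k • (Y + l • y)) (k • (X + l • x)) k) (u := k * w)
      (rowVec_mem_stdSimplex_iff.2 ⟨hq.1, hq.2.1, le_rfl, hkw.le, by linarith⟩)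
      (colVec_mem_stdSimplex_iff.2 ⟨hr.1, hr.2.1, hkpos.le, by linarith⟩)
      (le_vecMul_gameBM_iff.2 ⟨by simpa using hq.2.2.1, by simpa using hq.2.2.2, by
        simp only [dotProduct_smul, smul_eq_mul]
        have h1 := mul_le_mul_of_nonneg_left hle (sub_nonneg.2 hkw1)
        have h2 : (1 - k * w) * w = k * w + M * (k * w) := by
          linear_combination (-w) * hk1
        linarith⟩)
      (mulVec_gameBM_le_iff.2 ⟨hr.2.2.1, hr.2.2.2, by
        simp only [dotProduct_smul, dotProduct_add, smul_eq_mul]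
        have h1 : k * (b ⬝ᵥ Y + l * b ⬝ᵥ y) - k * (c ⬝ᵥ X + l * c ⬝ᵥ x) =
          k * ((b ⬝ᵥ Y - c ⬝ᵥ X) - l * (c ⬝ᵥ x - b ⬝ᵥ y)) := by ring
        rw [h1]
        have h2 : 0 ≤ l * (c ⬝ᵥ x - b ⬝ᵥ y) := mul_nonneg hlpos (by linarith)
        have h3 : k * ((b ⬝ᵥ Y - c ⬝ᵥ X) - l * (c ⬝ᵥ x - b ⬝ᵥ y)) ≤ 0 :=
          mul_nonpos_of_nonneg_of_nonpos hkpos.le (by linarith)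
        linarith, by linarith⟩)
    rw [hv]
    exact ⟨⟨_, this.1⟩, ⟨_, this.2⟩⟩

/-- At value zero the last row excludes `t = 0`. Dividing by `t` yields feasible solutions with `bᵀy
≤ cᵀx`, optimal by weak duality. -/
theorem partA_of_isGameValue {M v : ℝ} (hv : IsGameValue (gameBM A b c M) v)
    (hiff : v = 0 ↔ BothFeasible A b c) : PartA A b c M v := by
  have key : v = 0 → ∀ y x t, IsMinMaxStrategy (gameBM A b c M) (colVec y x t) →
      0 < t ∧ IsMaxMinStrategy (gameBM A b c M) (rowVec y x t 0) ∧
      IsPrimalOptimal A b c (t⁻¹ • x) ∧ IsDualOptimal A b c (t⁻¹ • y) := by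
    rintro rfl y x t ⟨u, hu⟩
    obtain rfl := hv.eq_of_isMinMaxWithValue hu
    obtain ⟨hy, hx, ht, hsum⟩ := colVec_mem_stdSimplex_iff.1 hu.1
    obtain ⟨h1, h2, h3, h4⟩ := mulVec_gameBM_le_iff.1 hu.2.1
    have htpos : 0 < t := by
      refine lt_of_le_of_ne ht fun h0 => ?_
      rw [← h0] at h4 hsum
      linarith
    have hr := IsRelaxedPair.smul (inv_nonneg.2 ht) (show IsRelaxedPair A b c t 0 y x from
      ⟨hy, hx, h1, h2⟩)
    rw [inv_mul_cancel₀ htpos.ne', mul_zero] at hr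
    obtain ⟨hP, hD⟩ := isRelaxedPair_one_zero_iff.1 hr
    have hgap : b ⬝ᵥ (t⁻¹ • y) ≤ c ⬝ᵥ (t⁻¹ • x) := by
      simp only [dotProduct_smul, smul_eq_mul]
      exact mul_le_mul_of_nonneg_left (by linarith) (inv_nonneg.2 ht)
    refine ⟨htpos, ⟨0, (isMaxMinWithValue_of_le (rowVec_mem_stdSimplex_iff.2
      ⟨hy, hx, ht, le_rfl, by linarith⟩) hu.1 (le_vecMul_gameBM_iff.2 ⟨by simpa using h1,
      by simpa using h2, by simpa using h3⟩) hu.2.1).1⟩, ⟨hP, fun x' hx' => ?_⟩,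
      ⟨hD, fun y' hy' => ?_⟩⟩
    · have := (isRelaxedPair_one_zero_iff.2 ⟨hx', hD⟩).cross hr
      linarith
    · have := hr.cross (isRelaxedPair_one_zero_iff.2 ⟨hP, hy'⟩)
      linarith
  refine ⟨hiff, fun h0 => ⟨?_, key h0⟩⟩
  obtain ⟨z, hz⟩ := hv.2
  have hz' : z = colVec (z ∘ .inl) (z ∘ .inr ∘ .inl) (z (.inr (.inr ()))) := by
    ext (i | j | k) <;> rfl
  have hzs : IsMinMaxStrategy (gameBM A b c M)
    (colVec (z ∘ .inl) (z ∘ .inr ∘ .inl) (z (.inr (.inr ())))) := ⟨v, hz' ▸ hz⟩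
  exact ⟨_, _, _, hzs, (key h0 _ _ _ hzs).2.1⟩

theorem IsLeastRelaxation.partB {Y : Fin m → ℝ} {X : Fin n → ℝ} {w M : ℝ}
    (h : IsLeastRelaxation A b c Y X w) (hM : ∑ i, Y i + ∑ j, X j + 1 ≤ M) :
    PartB A b c M (w / (M + w + 1)) := by
  intro hv
  have hgv := h.isGameValue hM
  have hbf := bothFeasible_iff h
  obtain ⟨hYX, hw, hgap, hcert⟩ := h
  have hS : 0 ≤ ∑ i, Y i + ∑ j, X j :=
    add_nonneg (Finset.sum_nonneg fun i _ => hYX.1 i) (Finset.sum_nonneg fun j _ => hYX.2.1 j)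
  have hwpos : 0 < w := by
    refine lt_of_le_of_ne hw fun h0 => ?_
    rw [← h0, zero_div] at hv
    exact lt_irrefl _ hv
  have hden : 0 < M + w + 1 := by linarith
  have hvw : w / (M + w + 1) * (M + w + 1) = w := div_mul_cancel₀ _ hden.ne'
  have hv1 : w / (M + w + 1) < 1 := (div_lt_one hden).2 (by linarith)
  have hweq : (M + 1) / (1 / (w / (M + w + 1)) - 1) = w := by
    rw [one_div_div, div_sub_one hwpos.ne']
    have : M + w + 1 - w ≠ 0 := by linarith
    have : M + 1 ≠ 0 := by linarith
    field_simp
    ring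
  refine ⟨fun y x r s ⟨u, hu⟩ => ?_, fun hc => hwpos.ne' (hbf.1 hc), hv1, ?_⟩
  · obtain rfl := hgv.eq_of_isMaxMinWithValue hu
    set v := w / (M + w + 1)
    obtain ⟨hy, hx, hr, hs, hsum⟩ := rowVec_mem_stdSimplex_iff.1 hu.1
    obtain ⟨h1, h2, h3⟩ := le_vecMul_gameBM_iff.1 hu.2.1
    have hpair : IsRelaxedPair A b c r (s - v) y x := ⟨hy, hx, h1, h2⟩
    have hy0 : 0 ≤ ∑ i, y i := Finset.sum_nonneg fun i _ => hy i
    have hx0 : 0 ≤ ∑ j, x j := Finset.sum_nonneg fun j _ => hx j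
    -- If `s < v`, crossing the pair with itself forces `y`, `x` and `r` to vanish, so `s = 1`,
    -- contradicting `v < 1`.
    have hsv : v ≤ s := by
      by_contra! hlt
      have hself := hpair.cross hpair
      have e1 : 0 ≤ (v - s) * (∑ i, y i + ∑ j, x j) :=
        mul_nonneg (by linarith) (add_nonneg hy0 hx0)
      have hMs : 0 ≤ M * s := mul_nonneg (by linarith) hs
      have e2 : r * (b ⬝ᵥ y - c ⬝ᵥ x) ≤ r * -(v + M * s) := mul_le_mul_of_nonneg_left h3 hr
      have e3 : 0 ≤ r * (v + M * s) := mul_nonneg hr (by linarith)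
      have e4 : (v - s) * (∑ i, y i + ∑ j, x j) = 0 := by linarith
      have e5 : r * (v + M * s) = 0 := by linarith
      have e6 : ∑ i, y i + ∑ j, x j = 0 := (mul_eq_zero.1 e4).resolve_left (by linarith)
      have e7 : r = 0 := (mul_eq_zero.1 e5).resolve_right (by linarith)
      linarith
    have c1 := hpair.cross hYX
    have c2 := hYX.cross hpair
    have hrg : r * (b ⬝ᵥ Y - c ⬝ᵥ X) ≤ 0 := mul_nonpos_of_nonneg_of_nonpos hr (by linarith)
    -- Sum of the two crossings with `(Y, X)`, using `v * (M + w + 1) = w`. Both summands are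
    -- nonnegative and the factors `w` and `w + M - ∑ Y - ∑ X` are positive, which forces `r = 0`
    -- and `s = v`.
    have c3 : r * w + (s - v) * (w + M - (∑ i, Y i + ∑ j, X j)) ≤ 0 := by
      have e : w * (∑ i, y i + ∑ j, x j) = w * (1 - r - s) := by
        congr 1
        linarith
      have e' := hvw
      simp only [mul_add, mul_sub, sub_mul] at c1 c2 e e' hrg ⊢
      linarith
    have c4 : 0 ≤ (s - v) * (w + M - (∑ i, Y i + ∑ j, X j)) :=
      mul_nonneg (by linarith) (by linarith)
    have c5 : 0 ≤ r * w := mul_nonneg hr hw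
    have hr0 : r = 0 := (mul_eq_zero.1 (le_antisymm (by linarith) c5)).resolve_right hwpos.ne'
    have hs0 : s - v = 0 := (mul_eq_zero.1 (le_antisymm (by linarith) c4)).resolve_right
      (by linarith)
    rw [hr0, hs0] at h1 h2
    refine ⟨hr0, sub_eq_zero.1 hs0, fun i => by simpa using h1 i, hx, fun j => by simpa using h2 j,
      hy, ?_⟩
    have : 0 ≤ M * s := mul_nonneg (by linarith) hs
    linarith
  · rw [hweq]
    obtain ⟨y, x, hyx, hsum, hle⟩ := hcert hwpos
    refine ⟨⟨X, Y, fun i => ?_, hYX.2.1, fun j => ?_, hYX.1⟩, ?_⟩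
    · simpa using hYX.2.2.1 i
    · have := hYX.2.2.2 j
      linarith
    · rintro w' ⟨x', y', h1, hx', h2, hy'⟩
      have := hyx.le_of_certificate hsum (α := 1) (β := w') ⟨hy', hx', fun i => by
        simpa using h1 i, fun j => by linarith [h2 j]⟩
      linarith

theorem IsLeastRelaxation.isSuitable {Y : Fin m → ℝ} {X : Fin n → ℝ} {w M : ℝ}
    (h : IsLeastRelaxation A b c Y X w) (hM : ∑ i, Y i + ∑ j, X j + 1 ≤ M) :
    IsSuitable A b c M := by
  have hS : 0 ≤ ∑ i, Y i + ∑ j, X j :=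
    add_nonneg (Finset.sum_nonneg fun i _ => h.1.1 i) (Finset.sum_nonneg fun j _ => h.1.2.1 j)
  have hbf := bothFeasible_iff h
  have hden : 0 < M + w + 1 := by linarith [h.2.1]
  refine ⟨fun hb => ?_, w / (M + w + 1), h.isGameValue hM, div_nonneg h.2.1 hden.le,
    partA_of_isGameValue (h.isGameValue hM) ?_, h.partB hM⟩
  · obtain rfl := hbf.1 hb
    have := isRelaxedPair_one_zero_iff.1 h.1
    exact ⟨X, Y, this.1, this.2, by linarith⟩
  · rw [hbf, div_eq_zero_iff]
    exact ⟨fun h => h.resolve_right hden.ne', Or.inl⟩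

end

/-! ### The least relaxation as a linear program -/

/-- The constraint matrix of: minimize `w` subject to `A x ≤ b + w 1`, `-Aᵀ y ≤ -c + w 1`,
`bᵀ y ≤ cᵀ x` and `y, x, w ≥ 0`. -/
def relaxationMatrix {m n : ℕ} (A : Matrix (Fin m) (Fin n) ℝ)
    (b : Fin m → ℝ) (c : Fin n → ℝ) : Matrix (Fin m ⊕ Fin n ⊕ Unit) (Fin m ⊕ Fin n ⊕ Unit) ℝ :=
  Matrix.of fun
    | .inl _, .inl _ => 0
    | .inl i, .inr (.inl j) => A i j
    | .inl _, .inr (.inr _) => -1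
    | .inr (.inl j), .inl i => -A i j
    | .inr (.inl _), .inr (.inl _) => 0
    | .inr (.inl _), .inr (.inr _) => -1
    | .inr (.inr _), .inl i => b i
    | .inr (.inr _), .inr (.inl j) => -c j
    | .inr (.inr _), .inr (.inr _) => 0

/-- The right-hand side of the linear program with matrix `relaxationMatrix`. -/
def relaxationRhs {m n : ℕ} (b : Fin m → ℝ) (c : Fin n → ℝ) :
    Fin m ⊕ Fin n ⊕ Unit → ℝ :=
  Sum.elim b (Sum.elim (-c) 0)

section

variable {m n : ℕ} {A : Matrix (Fin m) (Fin n) ℝ} {b : Fin m → ℝ} {c : Fin n → ℝ}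

theorem relaxationMatrix_mulVec_le_iff {y : Fin m → ℝ} {x : Fin n → ℝ} {w : ℝ} :
    relaxationMatrix A b c *ᵥ colVec y x w ≤ relaxationRhs b c ↔
      (∀ i, (A *ᵥ x) i ≤ 1 * b i + w) ∧ (∀ j, 1 * c j - w ≤ (Aᵀ *ᵥ y) j) ∧
        b ⬝ᵥ y ≤ c ⬝ᵥ x := by
  simp only [Pi.le_def, Sum.forall, Unique.forall_iff, relaxationMatrix, relaxationRhs, colVec,
    mulVec, dotProduct, of_apply, Pi.neg_apply, Pi.zero_apply,
    Fintype.sum_sum_type, Sum.elim_inl, Sum.elim_inr, zero_mul, Finset.sum_const_zero, zero_add,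
    Finset.univ_unique, Finset.sum_singleton, neg_mul, Finset.sum_neg_distrib, transpose_apply,
    one_mul, add_zero]
  refine and_congr (forall_congr' fun i => ?_) (and_congr (forall_congr' fun i => ?_) ?_) <;>
    constructor <;> intro h <;> linarith

theorem le_vecMul_relaxationMatrix_iff {y : Fin m → ℝ} {x : Fin n → ℝ} {r : ℝ} :
    0 ≤ colVec y x r ᵥ* relaxationMatrix A b c + colVec 0 0 1 ↔
      (∀ i, (A *ᵥ x) i ≤ r * b i + 0) ∧ (∀ j, r * c j - 0 ≤ (Aᵀ *ᵥ y) j) ∧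
        ∑ i, y i + ∑ j, x j ≤ 1 := by
  simp only [Pi.le_def, Sum.forall, Unique.forall_iff, relaxationMatrix, colVec, vecMul, mulVec,
    dotProduct, of_apply, Pi.zero_apply, Pi.add_apply,
    Fintype.sum_sum_type, Sum.elim_inl, Sum.elim_inr, mul_zero, Finset.sum_const_zero, zero_add,
    Finset.univ_unique, Finset.sum_singleton, mul_neg, Finset.sum_neg_distrib, transpose_apply,
    mul_one, add_zero]
  refine and_congr (forall_congr' fun i => ?_) (and_congr (forall_congr' fun j => ?_) ?_)
  · rw [Finset.sum_congr rfl fun j _ => mul_comm (x j) (A i j)]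
    constructor <;> intro h <;> linarith
  · rw [Finset.sum_congr rfl fun i _ => mul_comm (y i) (A i j)]
    constructor <;> intro h <;> linarith
  · constructor <;> intro h <;> linarith

theorem eq_colVec (z : Fin m ⊕ Fin n ⊕ Unit → ℝ) :
    z = colVec (z ∘ .inl) (z ∘ .inr ∘ .inl) (z (.inr (.inr ()))) := by
  ext (i | j | k) <;> rfl

/-- The least relaxation of (P) and (D) is attained at a basic solution. -/
theorem exists_basic_isLeastRelaxation (A : Matrix (Fin m) (Fin n) ℝ) (b : Fin m → ℝ)
    (c : Fin n → ℝ) : ∃ Y X w, IsLeastRelaxation A b c Y X w ∧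
      ∃ (f : Fin m ⊕ Fin n ⊕ Unit → (Fin m ⊕ Fin n ⊕ Unit) ⊕ (Fin m ⊕ Fin n ⊕ Unit))
        (u : Fin m ⊕ Fin n ⊕ Unit → ℝ),
        ((fromCols (relaxationMatrix A b c) 1).submatrix id f).det ≠ 0 ∧
        (fromCols (relaxationMatrix A b c) 1).submatrix id f *ᵥ u = relaxationRhs b c ∧
        ∑ i, Y i + ∑ j, X j ≤ ∑ k, |u k| := by
  have hb0 : 0 ≤ ∑ i, |b i| := Finset.sum_nonneg fun i _ => abs_nonneg _
  have hc0 : 0 ≤ ∑ j, |c j| := Finset.sum_nonneg fun i _ => abs_nonneg _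
  have hbi : ∀ i, |b i| ≤ ∑ i, |b i| := fun i =>
    Finset.single_le_sum (f := fun i => |b i|) (fun i _ => abs_nonneg _) (Finset.mem_univ i)
  have hcj : ∀ j, |c j| ≤ ∑ j, |c j| := fun j =>
    Finset.single_le_sum (f := fun i => |c i|) (fun i _ => abs_nonneg _) (Finset.mem_univ j)
  obtain ⟨z, p, hz, hGz, hp, hGp, hopt, f, u, hdet, hu, hsum⟩ :=
    lp_exists_basic_optimal (relaxationMatrix A b c) (relaxationRhs b c) (colVec 0 0 1)
    (z₀ := colVec 0 0 (∑ i, |b i| + ∑ j, |c j|)) (by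
      rintro (i | j | k) <;> simp [colVec]
      linarith)
    (relaxationMatrix_mulVec_le_iff.2 ⟨fun i => by
        simp only [mulVec_zero, Pi.zero_apply]
        linarith [neg_abs_le (b i), hbi i], fun j => by
        simp only [mulVec_zero, Pi.zero_apply]
        linarith [le_abs_self (c j), hcj j], by simp⟩)
    (p₀ := 0) le_rfl (by
      rw [zero_vecMul, zero_add]
      rintro (i | j | k) <;> simp [colVec])
  obtain ⟨Y, X, w, rfl⟩ : ∃ Y X w, z = colVec Y X w := ⟨_, _, _, eq_colVec z⟩
  obtain ⟨y, x, r, rfl⟩ : ∃ y x r, p = colVec y x r := ⟨_, _, _, eq_colVec p⟩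
  obtain ⟨g1, g2, g3⟩ := relaxationMatrix_mulVec_le_iff.1 hGz
  obtain ⟨d1, d2, d3⟩ := le_vecMul_relaxationMatrix_iff.1 hGp
  have hYX : IsRelaxedPair A b c 1 w Y X := ⟨fun i => hz (.inl i), fun j => hz (.inr (.inl j)), g1, g2⟩
  have hyx : IsRelaxedPair A b c r 0 y x := ⟨fun i => hp (.inl i), fun j => hp (.inr (.inl j)), d1, d2⟩
  have hw : 0 ≤ w := hz (.inr (.inr ()))
  have hr : 0 ≤ r := hp (.inr (.inr ()))
  have hle : w ≤ c ⬝ᵥ x - b ⬝ᵥ y := by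
    simp [colVec, relaxationRhs, dotProduct, Fintype.sum_sum_type] at hopt
    simp only [dotProduct]
    rw [Finset.sum_congr rfl fun i _ => mul_comm (y i) (b i),
      Finset.sum_congr rfl fun i _ => mul_comm (x i) (c i)] at hopt
    linarith
  refine ⟨Y, X, w, ⟨hYX, hw, g3, fun hwpos => ⟨y, x, ?_, ?_, hle⟩⟩, f, u, hdet, hu, ?_⟩
  -- The multiplier `r` of the constraint `bᵀy ≤ cᵀx` vanishes when `w > 0`: self-crossing gives `r
  -- * (cᵀx - bᵀy) ≤ 0`, while `cᵀx - bᵀy ≥ w`.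
  · have h1 := hyx.cross hyx
    have h2 : r * w ≤ r * (c ⬝ᵥ x - b ⬝ᵥ y) := mul_le_mul_of_nonneg_left hle hr
    have h3 : r * w = 0 := le_antisymm (by linarith) (mul_nonneg hr hw)
    obtain rfl := (mul_eq_zero.1 h3).resolve_right hwpos.ne'
    exact hyx
  · refine le_antisymm d3 ?_
    have h1 := hyx.cross hYX
    have h2 := hYX.cross hyx
    have h3 : r * (b ⬝ᵥ Y - c ⬝ᵥ X) ≤ 0 := mul_nonpos_of_nonneg_of_nonpos hr (by linarith)
    refine le_of_mul_le_mul_left (?_ : w * 1 ≤ w * _) hwpos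
    linarith
  · simp only [Fintype.sum_sum_type, colVec, Sum.elim_inl, Sum.elim_inr, Finset.univ_unique,
      Finset.sum_singleton] at hsum ⊢
    linarith

end

/-! ### Explicit bounds for rational data -/

/-- `x` is a rational number with numerator at most `α` in absolute value and denominator at
most `β`. -/
def IsRatOfHeight (α β : ℕ) (x : ℝ) : Prop :=
  ∃ q : ℚ, x = q ∧ q.num.natAbs ≤ α ∧ q.den ≤ β

theorem IsRatOfHeight.abs_le {α β : ℕ} {x : ℝ} (h : IsRatOfHeight α β x) : |x| ≤ α := by
  obtain ⟨q, rfl, hn, hd⟩ := h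
  have h1 : (q.num.natAbs : ℝ) = |(q : ℝ)| * q.den := by
    have h : ((q : ℝ) * q.den) = q.num := by exact_mod_cast Rat.mul_den_eq_num q
    rw [Nat.cast_natAbs, Int.cast_abs, ← h, abs_mul, Nat.abs_cast]
  have h2 : (1 : ℝ) ≤ q.den := by exact_mod_cast q.pos
  have h3 : (q.num.natAbs : ℝ) ≤ α := by exact_mod_cast hn
  nlinarith [abs_nonneg (q : ℝ)]

/-- Cramer's rule bounds the solution of a regular system with rational coefficients. -/
theorem abs_le_of_mulVec_eq {R : Type*} [Fintype R] [DecidableEq R] {α β : ℕ}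
    {Q : Matrix R R ℝ} {u h : R → ℝ} (hQ : ∀ i j, IsRatOfHeight α β (Q i j))
    (hh : ∀ i, IsRatOfHeight α β (h i)) (hdet : Q.det ≠ 0) (hu : Q *ᵥ u = h) (k : R) :
    |u k| ≤ (Fintype.card R).factorial * (α : ℝ) ^ Fintype.card R *
      (β : ℝ) ^ (Fintype.card R ^ 2) := by
  have hcramer : Q.det * u k = (Q.updateCol k h).det := by
    rw [← cramer_apply, ← hu, cramer_eq_adjugate_mulVec, mulVec_mulVec, adjugate_mul,
      smul_mulVec, one_mulVec]
    rfl
  have hle : |(Q.updateCol k h).det| ≤ (Fintype.card R).factorial • (α : ℝ) ^ Fintype.card R := by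
    refine det_le (abv := AbsoluteValue.abs) fun i j => ?_
    rw [updateCol_apply]
    split_ifs
    · exact (hh i).abs_le
    · exact (hQ i j).abs_le
  choose q hq _ hqd using hQ
  -- Scaling each row by the product of its denominators gives an integer matrix, whose nonzero
  -- determinant has absolute value at least 1.
  have hint : 1 ≤ (∏ i, ∏ j, ((q i j).den : ℝ)) * |Q.det| := by
    have h1 := det_mul_column (fun i => ∏ j, ((q i j).den : ℝ)) Q
    have h2 : ∀ i j, ∃ z : ℤ, (z : ℝ) = (∏ j, ((q i j).den : ℝ)) * Q i j := fun i j => by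
      refine ⟨(∏ l ∈ Finset.univ.erase j, ((q i l).den : ℤ)) * (q i j).num, ?_⟩
      rw [← Finset.mul_prod_erase _ _ (Finset.mem_univ j), hq]
      push_cast
      have : ((q i j).num : ℝ) = (q i j).den * (q i j : ℝ) := by
        exact_mod_cast (Rat.den_mul_eq_num (q i j)).symm
      rw [this]
      ring
    choose Z hZ using h2
    have h3 : ((Matrix.of Z).det : ℝ) = (∏ i, ∏ j, ((q i j).den : ℝ)) * Q.det := by
      rw [← h1]
      change Int.castRingHom ℝ _ = _
      rw [RingHom.map_det]
      congr 1
      ext i j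
      simpa using hZ i j
    have hpos : 0 < ∏ i, ∏ j, ((q i j).den : ℝ) :=
      Finset.prod_pos fun i _ => Finset.prod_pos fun j _ => by exact_mod_cast (q i j).pos
    have h4 : (Matrix.of Z).det ≠ 0 := fun h0 => by
      rw [h0, Int.cast_zero] at h3
      exact (mul_ne_zero hpos.ne' hdet) h3.symm
    have h5 := Int.one_le_abs h4
    calc (1 : ℝ) ≤ |((Matrix.of Z).det : ℝ)| := by exact_mod_cast h5
      _ = _ := by rw [h3, abs_mul, abs_of_pos hpos]
  have hden : ∏ i, ∏ j, ((q i j).den : ℝ) ≤ (β : ℝ) ^ (Fintype.card R ^ 2) := by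
    calc ∏ i, ∏ j, ((q i j).den : ℝ) ≤ ∏ _i : R, ∏ _j : R, (β : ℝ) :=
          Finset.prod_le_prod (fun i _ => Finset.prod_nonneg fun j _ => Nat.cast_nonneg _)
            fun i _ => Finset.prod_le_prod (fun j _ => Nat.cast_nonneg _)
              fun j _ => by exact_mod_cast hqd i j
      _ = _ := by simp [← pow_mul, sq]
  rw [nsmul_eq_mul] at hle
  calc |u k| ≤ ((∏ i, ∏ j, ((q i j).den : ℝ)) * |Q.det|) * |u k| :=
        le_mul_of_one_le_left (abs_nonneg _) hint
    _ = (∏ i, ∏ j, ((q i j).den : ℝ)) * |(Q.updateCol k h).det| := by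
        rw [← hcramer, abs_mul, mul_assoc]
    _ ≤ (β : ℝ) ^ (Fintype.card R ^ 2) *
          ((Fintype.card R).factorial * (α : ℝ) ^ Fintype.card R) :=
        mul_le_mul hden hle (abs_nonneg _) (by positivity)
    _ = _ := by ring

section

variable {m n : ℕ} {A : Matrix (Fin m) (Fin n) ℚ} {b : Fin m → ℚ} {c : Fin n → ℚ}

theorem isRatOfHeight_dataEntry (e : (Fin m × Fin n) ⊕ Fin m ⊕ Fin n) :
    IsRatOfHeight (maxNum A b c) (maxDen A b c) (dataEntry A b c e : ℝ) :=
  ⟨_, rfl, Finset.le_sup (f := fun e => (dataEntry A b c e).num.natAbs) (Finset.mem_univ e),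
    Finset.le_sup (f := fun e => (dataEntry A b c e).den) (Finset.mem_univ e)⟩

theorem IsRatOfHeight.neg {α β : ℕ} {x : ℝ} (h : IsRatOfHeight α β x) :
    IsRatOfHeight α β (-x) := by
  obtain ⟨q, rfl, hn, hd⟩ := h
  exact ⟨-q, by simp, by simpa using hn, by simpa using hd⟩

theorem IsRatOfHeight.zero {α β : ℕ} (hβ : 1 ≤ β) : IsRatOfHeight α β 0 :=
  ⟨0, by simp, by simp, by simpa using hβ⟩

theorem IsRatOfHeight.one {α β : ℕ} (hα : 1 ≤ α) (hβ : 1 ≤ β) : IsRatOfHeight α β 1 :=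
  ⟨1, by simp, by simpa using hα, by simpa using hβ⟩

theorem one_le_maxDen (hm : 0 < m) : 1 ≤ maxDen A b c :=
  le_trans (dataEntry A b c (.inr (.inl ⟨0, hm⟩))).pos
    (Finset.le_sup (f := fun e => (dataEntry A b c e).den) (Finset.mem_univ _))

/-- Rational data have a suitable constant of explicitly bounded size. -/
theorem isSuitable_explicitM (hm : 0 < m) (A : Matrix (Fin m) (Fin n) ℚ) (b : Fin m → ℚ)
    (c : Fin n → ℚ) :
    IsSuitable (A.map fun q => (q : ℝ)) (fun i => (b i : ℝ)) (fun j => (c j : ℝ))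
      (explicitM A b c : ℝ) := by
  have hβ : 1 ≤ maxDen A b c := one_le_maxDen hm
  have hA : ∀ i j, IsRatOfHeight (maxNum A b c) (maxDen A b c) (A i j : ℝ) := fun i j =>
    isRatOfHeight_dataEntry (.inl (i, j))
  have hb : ∀ i, IsRatOfHeight (maxNum A b c) (maxDen A b c) (b i : ℝ) := fun i =>
    isRatOfHeight_dataEntry (.inr (.inl i))
  have hc : ∀ j, IsRatOfHeight (maxNum A b c) (maxDen A b c) (c j : ℝ) := fun j =>
    isRatOfHeight_dataEntry (.inr (.inr j))
  rcases Nat.eq_zero_or_pos (maxNum A b c) with hα | hα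
  -- The case `α = 0` is separate because the entries `±1` of the relaxation matrix would exceed the
  -- height bound. All data vanish, so the zero solution serves.
  · have hz : ∀ x : ℝ, IsRatOfHeight (maxNum A b c) (maxDen A b c) x → x = 0 := fun x hx => by
      have := hx.abs_le
      rw [hα, Nat.cast_zero] at this
      exact abs_nonpos_iff.1 this
    refine IsLeastRelaxation.isSuitable (Y := 0) (X := 0) (w := 0) ⟨⟨le_rfl, le_rfl, fun i => ?_,
      fun j => ?_⟩, le_rfl, by simp, fun h => absurd h (lt_irrefl _)⟩ ?_
    · simp [hz _ (hb i)]
    · simp [hz _ (hc j)]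
    · simp only [Pi.zero_apply, Finset.sum_const_zero, explicitM, Nat.cast_add, Nat.cast_one]
      linarith [Nat.cast_nonneg (α := ℝ) ((m + n + 1).factorial * (m + n + 1) *
        maxNum A b c ^ (m + n + 1) * maxDen A b c ^ ((m + n + 1) ^ 2 + (m + n + 1)))]
  · obtain ⟨Y, X, w, h, f, u, hdet, hu, hsum⟩ := exists_basic_isLeastRelaxation
      (A.map fun q => (q : ℝ)) (fun i => (b i : ℝ)) (fun j => (c j : ℝ))
    refine h.isSuitable ?_
    have h0 := IsRatOfHeight.zero (α := maxNum A b c) hβ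
    have h1 := IsRatOfHeight.one hα hβ
    have hk := abs_le_of_mulVec_eq (α := maxNum A b c) (β := maxDen A b c) (fun i j => by
      rw [submatrix_apply]
      rcases f j with j | j
      · rw [fromCols_apply_inl]
        rcases i with i | i | i <;> rcases j with j | j | j <;>
          simp only [relaxationMatrix, of_apply, map_apply, id]
        · exact h0
        · exact hA _ _
        · exact h1.neg
        · exact (hA _ _).neg
        · exact h0
        · exact h1.neg
        · exact hb _
        · exact (hc _).neg
        · exact h0
      · rw [fromCols_apply_inr, one_apply]
        split_ifs
        · exact h1
        · exact h0) (fun i => by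
      rcases i with i | i | i
      · exact hb i
      · exact (hc i).neg
      · exact h0) hdet hu
    have hcard : Fintype.card (Fin m ⊕ Fin n ⊕ Unit) = m + n + 1 := by simp [add_assoc]
    rw [hcard] at hk
    have hsum' := Finset.sum_le_sum fun k (_ : k ∈ Finset.univ) => hk k
    rw [Finset.sum_const, Finset.card_univ, hcard, nsmul_eq_mul] at hsum'
    -- Cramer's rule already gives the exponent `ℓ²`; the larger exponent in `explicitM` only
    -- weakens the bound.
    have hpow : (maxDen A b c : ℝ) ^ ((m + n + 1) ^ 2) ≤
        (maxDen A b c : ℝ) ^ ((m + n + 1) ^ 2 + (m + n + 1)) :=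
      pow_le_pow_right₀ (by exact_mod_cast hβ) (Nat.le_add_right _ _)
    have hfin := mul_le_mul_of_nonneg_left hpow (show (0 : ℝ) ≤ (m + n + 1).factorial *
      ((m + n + 1 : ℕ) : ℝ) * (maxNum A b c : ℝ) ^ (m + n + 1) by positivity)
    have hM : (explicitM A b c : ℝ) = (m + n + 1).factorial *
      ((m + n + 1 : ℕ) : ℝ) * (maxNum A b c : ℝ) ^ (m + n + 1) *
        (maxDen A b c : ℝ) ^ ((m + n + 1) ^ 2 + (m + n + 1)) + 1 := by
      simp [explicitM]
    rw [hM]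
    linarith

theorem lt_two_pow_dataBitSize (e : (Fin m × Fin n) ⊕ Fin m ⊕ Fin n) :
    (dataEntry A b c e).num.natAbs < 2 ^ dataBitSize A b c ∧
      (dataEntry A b c e).den < 2 ^ dataBitSize A b c := by
  have h : ratBitSize (dataEntry A b c e) ≤ dataBitSize A b c :=
    Finset.single_le_sum (f := fun e => ratBitSize (dataEntry A b c e))
      (fun _ _ => Nat.zero_le _) (Finset.mem_univ e)
  unfold ratBitSize at h
  exact ⟨Nat.size_le.1 (by omega), Nat.size_le.1 (by omega)⟩

/-- Each of the `mn + m + n` entries contributes at least one bit, and `mn ≥ 1`. -/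
theorem dimension_le_dataBitSize (hm : 0 < m) (hn : 0 < n) : m + n + 1 ≤ dataBitSize A b c := by
  have h1 : ∑ _e : (Fin m × Fin n) ⊕ Fin m ⊕ Fin n, 1 ≤ dataBitSize A b c :=
    Finset.sum_le_sum fun e _ => by unfold ratBitSize; omega
  have h2 : 0 < m * n := Nat.mul_pos hm hn
  simp at h1
  omega

theorem size_explicitM_le (hm : 0 < m) (hn : 0 < n) : (explicitM A b c).size ≤
    dataBitSize A b c ^ 3 + 3 * dataBitSize A b c ^ 2 + dataBitSize A b c + 1 := by
  have hl := dimension_le_dataBitSize (A := A) (b := b) (c := c) hm hn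
  have hα : maxNum A b c ≤ 2 ^ dataBitSize A b c :=
    Finset.sup_le fun e _ => (lt_two_pow_dataBitSize e).1.le
  have hβ : maxDen A b c ≤ 2 ^ dataBitSize A b c :=
    Finset.sup_le fun e _ => (lt_two_pow_dataBitSize e).2.le
  unfold explicitM
  have hlpos : 0 < m + n + 1 := Nat.succ_pos _
  generalize m + n + 1 = l at *
  generalize dataBitSize A b c = N at *
  have hl2 : l ≤ 2 ^ N := hl.trans N.lt_two_pow_self.le
  have hpow : ∀ {a k K : ℕ}, a ≤ 2 ^ N → k ≤ K → a ^ k ≤ 2 ^ (N * K) := fun {a k K} ha hk => by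
    calc a ^ k ≤ (2 ^ N) ^ k := Nat.pow_le_pow_left ha _
      _ = 2 ^ (N * k) := (pow_mul _ _ _).symm
      _ ≤ 2 ^ (N * K) := Nat.pow_le_pow_right two_pos (Nat.mul_le_mul_left _ hk)
  have hfac : l.factorial ≤ 2 ^ (N * N) := l.factorial_le_pow.trans (hpow hl2 hl)
  have hβ' : maxDen A b c ^ (l ^ 2 + l) ≤ 2 ^ (N * (N ^ 2 + N)) :=
    hpow hβ (Nat.add_le_add (Nat.pow_le_pow_left hl 2) hl)
  have := Nat.mul_le_mul (Nat.mul_le_mul (Nat.mul_le_mul hfac hl2) (hpow hα hl)) hβ'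
  rw [← pow_add, ← pow_add, ← pow_add] at this
  refine Nat.size_le.2 (lt_of_le_of_lt (Nat.add_le_add_right this 1) ?_)
  have h3 : N ^ 3 + 3 * N ^ 2 + N + 1 = N * N + N + N * N + N * (N ^ 2 + N) + 1 := by ring
  rw [h3, pow_succ 2]
  -- The summand `+ 1` of `explicitM` costs at most one more binary digit, as the exponent is
  -- positive.
  have : 1 < 2 ^ (N * N + N + N * N + N * (N ^ 2 + N)) := by
    refine Nat.one_lt_two_pow (Nat.pos_of_ne_zero fun h0 => ?_).ne'
    omega
  omega

end

theorem theorem8p1 :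
    (∀ (m n : ℕ), 0 < m → 0 < n →
      ∀ (A : Matrix (Fin m) (Fin n) ℝ) (b : Fin m → ℝ) (c : Fin n → ℝ),
        ∃ M : ℝ, IsSuitable A b c M) ∧
    (∀ (m n : ℕ), 0 < m → 0 < n →
      ∀ (A : Matrix (Fin m) (Fin n) ℚ) (b : Fin m → ℚ) (c : Fin n → ℚ),
        IsSuitable (A.map fun q => (q : ℝ)) (fun i => (b i : ℝ)) (fun j => (c j : ℝ))
          (explicitM A b c : ℝ)) ∧
    (∃ p : Polynomial ℕ, ∀ (m n : ℕ), 0 < m → 0 < n →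
      ∀ (A : Matrix (Fin m) (Fin n) ℚ) (b : Fin m → ℚ) (c : Fin n → ℚ),
        (explicitM A b c).size ≤ p.eval (dataBitSize A b c)) := by
  refine ⟨fun m n _ _ A b c => ?_, fun m n hm _ A b c => isSuitable_explicitM hm A b c,
    Polynomial.X ^ 3 + 3 * Polynomial.X ^ 2 + Polynomial.X + 1, fun m n hm hn A b c => ?_⟩
  · obtain ⟨Y, X, w, h, -⟩ := exists_basic_isLeastRelaxation A b c
    -- The constant is `∑ Y + ∑ X + 1`, the smallest one allowed for this solution.
    exact ⟨_, h.isSuitable le_rfl⟩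
  · simpa using size_explicitM_le (A := A) (b := b) (c := c) hm hn
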